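/- Let $\prec$ be any total order on the positive integers, with weak version $\preceq$. For a composition $\alpha=(a_1,\dots,a_k)$ of $n$ let $S(\alpha)=\{a_1,\ a_1+a_2,\ \dots,\ a_1+\cdots+a_{k-1}\}\subseteq[n-1]$ be its set of interior partial sums, and write $\alpha\le\beta$ if $\beta$ is obtained from $\alpha$ by summing adjacent parts, i.e. $S(\beta)\subseteq S(\alpha)$. Let $$M_\alpha=\sum_{i_1<\cdots<i_k}x_{i_1}^{a_1}\cdots x_{i_k}^{a_k},\qquad F_\alpha=\sum_{\beta\le\alpha}M_\beta$$ be the monomial and fundamental quasisymmetric functions in the infinitely many variables $x_1,x_2,\dots$, with coefficients in a commutative ring. Let $C^\prec(\alpha)$ be the composition obtained from $\alpha$ by cutting it at its ascents (between $a_i$ and $a_{i+1}$ when $a_i\prec a_{i+1}$) and summing each piece; thus $S(C^\prec(\alpha))=\{a_1+\cdots+a_i : 1\le i<k,\ a_i\prec a_{i+1}\}$. Let $T^\prec(\alpha)$ be the composition obtained by cutting $\alpha$ between $a_i$ and $a_{i+1}$ whenever $a_i\preceq a_{i+1}$ and concatenating the ribbon transposes of the pieces; thus $S(T^\prec(\alpha))=[n-1]\setminus\{a_1+\cdots+a_i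 : 1\le i<k,\ a_i\succ a_{i+1}\}$. The quasisymmetric powersum induced by $\prec$ is $$P^\prec_\alpha=\sum_{\alpha\le\beta\le C^\prec(\alpha)}C_{\alpha\beta}M_\beta,\qquad C_{\alpha\beta}=\prod_{L=1}^n\frac{m_L(\alpha)!}{c_L(\alpha,\beta)!},$$ where $m_L(\alpha)$ is the number of parts of $\alpha$ equal to $L$, and $c_L(\alpha,\beta)!$ is the product, over the parts $b_j$ of $\beta$, of the factorials of the number of parts equal to $L$ among the parts of $\alpha$ that are summed to $b_j$. For compositions $\alpha=(a_1,\dots,a_k)$ and $\beta=(b_1,\dots,b_l)$ of $n$, let $R(\beta)$ be the connected ribbon with row lengths $b_1,\dots,b_l$ from top to bottom, in which each row starts directly below the last box of the row above it. Define a number $\mathrm{ht}(\beta,\alpha)$ and a tuple $D(\beta,\alpha)=(R_1,\dots,R_n)$ of (possibly empty) ribbons by the following algorithm. Start with $\mathrm{ht}=0$, $R=R(\beta)$ and all $R_j$ empty. For $i=1,\dots,k$: 1. Extend $R_{a_i}$ at its bottom right end by one box. The new box is placed - diagonally southeast of the last box, if $i=1$ or $a_{i-1}\ne a_i$ (if $R_{a_i}$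 is empty, the new box is its first box); - directly south of the last box, if $i>1$, $a_{i-1}=a_i$ and $R=R(b_j,\dots,b_l)$ for some $j$; - directly east of the last box, if $i>1$, $a_{i-1}=a_i$ and there is no such $j$. 2. Increase $\mathrm{ht}$ by the number of rows of $R$ that contain one of the first $a_i$ boxes of $R$ (from the top left), minus $1$; then remove these $a_i$ boxes from $R$. The final value of $\mathrm{ht}$ is $\mathrm{ht}(\beta,\alpha)$. Let $\mathrm{SDR}(\beta,\alpha)$ be the set of tuples of fillings of $R_1,\dots,R_n$ in which the boxes of each $R_j$ are labelled bijectively by $1,\dots,|R_j|$, such that labels increase from left to right in each row and decrease from top to bottom in each column. **Theorem.** For every total order $\prec$ on the positive integers and every composition $\alpha$, $$P^\prec_\alpha=\sum_{T^\prec(\alpha)\le\beta\le C^\prec(\alpha)}(-1)^{\mathrm{ht}(\beta,\alpha)}\,|\mathrm{SDR}(\beta,\alpha)|\,F_\beta .$$ -/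

import Mathlib

namespace QuasiPowersum

/-! ### Quasisymmetric functions

Formal power series over `R` in the variables `x₀, x₁, x₂, …`, indexed by `ℕ`. -/

open Classical in
/-- The monomial quasisymmetric function
`M_α = ∑_{i₁ < i₂ < ⋯ < i_k} x_{i₁}^{a₁} x_{i₂}^{a₂} ⋯ x_{i_k}^{a_k}` of `α = (a₁, …, a_k)`.
Different sequences `i₁ < ⋯ < i_k` give different monomials, so the coefficient of a monomial
is `1` if it is of this form and `0` otherwise. -/
noncomputable def monomialQ (R : Type*) [CommRing R] {n : ℕ} (α : Composition n) :
    MvPowerSeries ℕ R :=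
  fun d => if ∃ i : Fin α.length → ℕ, StrictMono i ∧
    d = ∑ j, Finsupp.single (i j) (α.blocksFun j) then 1 else 0

/-- The refinement order on compositions of `n`: `Refines α β` is `α ≤ β`, that is, `β` is obtained
from `α` by summing adjacent parts; equivalently, every partial sum of `β` is one of `α`. -/
def Refines {n : ℕ} (α β : Composition n) : Prop := β.boundaries ⊆ α.boundaries

instance {n : ℕ} (α β : Composition n) : Decidable (Refines α β) :=
  inferInstanceAs (Decidable (β.boundaries ⊆ α.boundaries))

/-- The fundamental quasisymmetric function `F_α = ∑_{β ≤ α} M_β`. -/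
noncomputable def fundamentalQ (R : Type*) [CommRing R] {n : ℕ} (α : Composition n) :
    MvPowerSeries ℕ R :=
  ∑ β : Composition n with Refines β α, monomialQ R β

/-! ### The compositions `C^≺(α)` and `T^≺(α)` -/

/-- The `i`-th part of a composition as a positive integer. -/
def part {n : ℕ} (α : Composition n) (i : Fin α.length) : ℕ+ :=
  ⟨α.blocksFun i, α.one_le_blocksFun i⟩

/-- For `α = (a₁, …, a_k)`, the set of those interior partial sums `a₁ + ⋯ + a_i`, `1 ≤ i < k`,
for which `p a_i a_{i+1}` holds. -/
def cutSet {n : ℕ} (α : Composition n) (p : ℕ+ → ℕ+ → Prop) [DecidableRel p] :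
    Finset (Fin (n + 1)) :=
  {s | ∃ i : Fin α.length, ∃ h : (i : ℕ) + 1 < α.length,
    (s : ℕ) = α.sizeUpTo (i + 1) ∧ p (part α i) (part α ⟨i + 1, h⟩)}

/-- The composition of `n` whose set of interior partial sums is `S \ {0, n}`. -/
def ofCuts {n : ℕ} (S : Finset (Fin (n + 1))) : Composition n :=
  (CompositionAsSet.mk (insert 0 (insert (Fin.last n) S)) (by simp) (by simp)).toComposition

/-- `C^≺(α) = (|γ₁|, …, |γ_l|)`, where `α = γ₁ | ⋯ | γ_l` is broken at its ascents
`a_i ≺ a_{i+1}`. -/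
def upperComp (prec : ℕ+ → ℕ+ → Prop) [DecidableRel prec] {n : ℕ} (α : Composition n) :
    Composition n :=
  ofCuts (cutSet α fun a b => prec a b)

/-- `T^≺(α) = γ₁' | ⋯ | γ_l'`, where `α = γ₁ | ⋯ | γ_l` is broken at every `i` with
`a_i ≼ a_{i+1}`, and `γ'` is the transposed ribbon. Transposing a ribbon complements its set of
interior partial sums, so that the interior partial sums of `T^≺(α)` are all of `1, …, n - 1` except
those `a₁ + ⋯ + a_i` with `a_i ≻ a_{i+1}`. -/
def lowerComp (prec : ℕ+ → ℕ+ → Prop) [DecidableRel prec] {n : ℕ} (α : Composition n) :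
    Composition n :=
  ofCuts (cutSet α fun a b => prec b a)ᶜ

/-! ### The quasisymmetric powersums -/

/-- `m_L(α)`: the number of parts of `α` equal to `L`. -/
def mult {n : ℕ} (L : ℕ) (α : Composition n) : ℕ :=
  Finset.card {i : Fin α.length | α.blocksFun i = L}

/-- For `α ≤ β`, the `j`-th entry of `c_L(α, β)`: the number of parts of `α` equal to `L` among
those that are summed to the `j`-th part of `β`. -/
def multIn {n : ℕ} (L : ℕ) (α β : Composition n) (j : Fin β.length) : ℕ :=
  Finset.card {i : Fin α.length | β.sizeUpTo j ≤ α.sizeUpTo i ∧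
    α.sizeUpTo (i + 1) ≤ β.sizeUpTo (j + 1) ∧ α.blocksFun i = L}

/-- `c_L(α, β)!`: the product of the factorials of the entries of `c_L(α, β)`. -/
def multInFactorial {n : ℕ} (L : ℕ) (α β : Composition n) : ℕ :=
  ∏ j : Fin β.length, (multIn L α β j).factorial

/-- `C_{αβ} = ∏_{L = 1}^n m_L(α)! / c_L(α, β)!`; the divisions are exact, see
`multInFactorial_dvd`. -/
def coeffC {n : ℕ} (α β : Composition n) : ℕ :=
  ∏ L ∈ Finset.Icc 1 n, (mult L α).factorial / multInFactorial L α β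

theorem multInFactorial_dvd {n : ℕ} (L : ℕ) (α β : Composition n) :
    multInFactorial L α β ∣ (mult L α).factorial := by
  refine (Nat.prod_factorial_dvd_factorial_sum _ _).trans (Nat.factorial_dvd_factorial ?_)
  unfold multIn mult
  rw [← Finset.card_biUnion]
  · refine Finset.card_le_card fun i hi => ?_
    simp only [Finset.mem_biUnion, Finset.mem_filter, Finset.mem_univ, true_and] at hi ⊢
    obtain ⟨j, -, -, h⟩ := hi
    exact h
  · have key : ∀ j k : Fin β.length, j < k → ∀ i : Fin α.length,
        α.sizeUpTo (i + 1) ≤ β.sizeUpTo (j + 1) → β.sizeUpTo k ≤ α.sizeUpTo i → False := by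
      intro j k hjk i h₁ h₂
      have h₃ := α.sizeUpTo_strict_mono i.2
      have h₄ := β.monotone_sizeUpTo (Nat.succ_le_of_lt (Fin.lt_def.1 hjk))
      simp only [Nat.succ_eq_add_one] at h₄
      omega
    intro j _ k _ hjk
    rw [Function.onFun, Finset.disjoint_left]
    intro i hi hi'
    simp only [Finset.mem_filter, Finset.mem_univ, true_and] at hi hi'
    rcases lt_or_gt_of_ne hjk with h | h
    · exact key j k h i hi.2.1 hi'.1
    · exact key k j h i hi'.2.1 hi.1

/-- The quasisymmetric powersum `P^≺_α = ∑_{α ≤ β ≤ C^≺(α)} C_{αβ} M_β`. -/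
noncomputable def powersumQ (R : Type*) [CommRing R] (prec : ℕ+ → ℕ+ → Prop) [DecidableRel prec]
    {n : ℕ} (α : Composition n) : MvPowerSeries ℕ R :=
  ∑ β : Composition n with Refines α β ∧ Refines β (upperComp prec α),
    (coeffC α β : R) • monomialQ R β

/-! ### Descent ribbons

A connected ribbon is given by its row lengths from top to bottom; `R(β)` is `β.blocks`. The ribbons
`R_k` that the algorithm builds, which may have consecutive boxes that share only a corner, are
lists of boxes `(row, column)` from the top left to the bottom right, where rows are
numbered downwards. -/

/-- The first `j` boxes of a connected ribbon. -/
def firstBoxes : ℕ → List ℕ → List ℕ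
  | _, [] => []
  | j, b :: bs => if j = 0 then [] else if j ≤ b then [j] else b :: firstBoxes (j - b) bs

/-- `R - j`: remove the first `j` boxes of a connected ribbon. -/
def removeBoxes : ℕ → List ℕ → List ℕ
  | _, [] => []
  | j, b :: bs => if j < b then (b - j) :: bs else removeBoxes (j - b) bs

/-- Extend a ribbon at its bottom right end by a box, `dr` rows down and `dc` columns to the right
of the last box (the first box is put at the origin). -/
def extend (dr dc : ℕ) (l : List (ℕ × ℕ)) : List (ℕ × ℕ) :=
  match l.getLast? with
  | none => [(0, 0)]
  | some (r, c) => l ++ [(r + dr, c + dc)]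

/-- The state of the algorithm: the previous part `a_{i-1}` (if there is one), the height, what is
left of the ribbon of `β`, and the ribbons `R_k`. -/
structure RibbonState where
  prev : Option ℕ
  ht : ℕ
  rem : List ℕ
  ribbons : ℕ → List (ℕ × ℕ)

/-- The iteration of the algorithm for the part `a`. The ribbon `R_a` is extended by a box in the
southeast position if `a` is the first part or differs from the previous part. If `a` equals the
previous part, the new box is in the south position if the remaining ribbon is `R(b_j, …, b_l)` for
some `j`, and in the east position otherwise. The height grows by the number of
rows of the ribbon of the next `a` boxes, minus one. -/
def ribbonStep (β : List ℕ) (s : RibbonState) (a : ℕ) : RibbonState where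
  prev := some a
  ht := s.ht + ((firstBoxes a s.rem).length - 1)
  rem := removeBoxes a s.rem
  ribbons := Function.update s.ribbons a
    (if s.prev ≠ some a then extend 1 1 (s.ribbons a)
     else if s.rem <:+ β then extend 1 0 (s.ribbons a)
     else extend 0 1 (s.ribbons a))

/-- The final state of the algorithm for `β` and `α`. -/
def ribbonRun {n : ℕ} (β α : Composition n) : RibbonState :=
  α.blocks.foldl (ribbonStep β.blocks) ⟨none, 0, β.blocks, fun _ => []⟩

/-- `ht(β, α)`. -/
def height {n : ℕ} (β α : Composition n) : ℕ := (ribbonRun β α).ht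

/-- The set of boxes of the ribbon `R_k` in `D(β, α) = (R₁, …, R_n)`. -/
def ribbonCells {n : ℕ} (β α : Composition n) (k : ℕ) : Finset (ℕ × ℕ) :=
  ((ribbonRun β α).ribbons k).toFinset

/-- A standard filling `f` of a finite set of boxes (each label used once) is a
standard descent ribbon filling if it is increasing from left to right in every row and decreasing
from top to bottom in every column. -/
def IsStandardDescent {S : Finset (ℕ × ℕ)} (f : S ≃ Fin S.card) : Prop :=
  (∀ x y : S, x.1.1 = y.1.1 → x.1.2 < y.1.2 → f x < f y) ∧
  (∀ x y : S, x.1.2 = y.1.2 → x.1.1 < y.1.1 → f y < f x)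

/-- `SDR(β, α)`: the tuples of standard descent ribbon fillings of
`D(β, α) = (R₁, …, R_n)`. -/
abbrev SDR {n : ℕ} (β α : Composition n) : Type :=
  (k : Finset.Icc 1 n) →
    {f : ribbonCells β α k ≃ Fin (ribbonCells β α k).card // IsStandardDescent f}

end QuasiPowersum

namespace QuasiPowersum

/-! ### Removing boxes from ribbons -/

/-! Expanding each `F_γ` into monomial functions reduces the theorem to one identity for each
composition `β` (`sum_neg_one_pow_height_mul_card_SDR`): the sum of `(-1)^ht(γ, α) |SDR(γ, α)|` over
`T(α) ≤ γ ≤ C(α)` with `β ≤ γ` is `C_{αβ}` if `α ≤ β ≤ C(α)`, and `0` otherwise.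

Both statistics depend only on sets of partial sums. The height is `|S(γ) \ S(α)|` (`height_eq`).
Fillings in `SDR(γ, α)` amount to labelings, for each `L`, of the parts of `α` equal to `L`, whose
descents between adjacent equal parts are exactly the plateaus of `α` lying in `S(γ)` (`card_SDR`).

If `S(β)` has a point `s` outside `S(α)`, adding or removing `s` in `S(γ)` changes the sign but not
the number of fillings, so everything cancels. If `α ≤ β`, all heights vanish. Then `S(γ)` contains
all ascents of `α`, none of its strict descents, and some plateaus, so each labeling with descents
in `S(β)` is counted for exactly one `γ` (`sum_card_SDR`). A part of `β` is a sum of weakly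
decreasing parts of `α`, among which equal ones are adjacent; hence these labelings are the ones
increasing on each part of `β`, and there are `∏ m_L! / c_L!` of them (`card_descents_subset`). -/

theorem removeBoxes_removeBoxes (l : List ℕ) (i j : ℕ) :
    removeBoxes i (removeBoxes j l) = removeBoxes (j + i) l := by
  induction l generalizing j with
  | nil => simp [removeBoxes]
  | cons b bs ih =>
    by_cases h : j < b
    · by_cases h' : j + i < b
      · simp only [removeBoxes, h, h', if_true, if_pos (show i < b - j by omega)]
        congr 1; omega
      · simp only [removeBoxes, h, h', if_true, if_false, if_neg (show ¬ i < b - j by omega)]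
        congr 1; omega
    · simp only [removeBoxes, h, if_false, if_neg (show ¬ j + i < b by omega), ih]
      congr 1; omega

theorem removeBoxes_zero {l : List ℕ} (hl : ∀ b ∈ l, 0 < b) : removeBoxes 0 l = l := by
  cases l with
  | nil => rfl
  | cons b bs => simp [removeBoxes, hl b (by simp)]

theorem pos_of_mem_removeBoxes {l : List ℕ} (hl : ∀ b ∈ l, 0 < b) (j : ℕ) :
    ∀ b ∈ removeBoxes j l, 0 < b := by
  induction l generalizing j with
  | nil => simp [removeBoxes]
  | cons b bs ih =>
    simp only [List.mem_cons, forall_eq_or_imp] at hl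
    by_cases h : j < b
    · simp only [removeBoxes, h, if_true, List.mem_cons, forall_eq_or_imp]
      exact ⟨by omega, hl.2⟩
    · simpa only [removeBoxes, h, if_false] using ih hl.2 _

theorem sum_removeBoxes (l : List ℕ) (j : ℕ) : (removeBoxes j l).sum = l.sum - j := by
  induction l generalizing j with
  | nil => simp [removeBoxes]
  | cons b bs ih =>
    by_cases h : j < b
    · simp only [removeBoxes, h, if_true, List.sum_cons]; omega
    · simp only [removeBoxes, h, if_false, List.sum_cons, ih]; omega

/-- `p` is a partial sum of the list `l`. -/
def IsPartialSum (l : List ℕ) (p : ℕ) : Prop := ∃ i, (l.take i).sum = p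

theorem isPartialSum_zero (l : List ℕ) : IsPartialSum l 0 := ⟨0, by simp⟩

theorem isPartialSum_cons (b : ℕ) (l : List ℕ) (p : ℕ) :
    IsPartialSum (b :: l) p ↔ p = 0 ∨ b ≤ p ∧ IsPartialSum l (p - b) := by
  constructor
  · rintro ⟨i, rfl⟩
    cases i with
    | zero => simp
    | succ i => exact Or.inr ⟨by simp, i, by simp⟩
  · rintro (rfl | ⟨h, i, hi⟩)
    · exact isPartialSum_zero _
    · exact ⟨i + 1, by simp; omega⟩

/-- Positivity of `p` matters: `0` is a partial sum of any list, whether or not `j` is one of `l`.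
-/
theorem isPartialSum_removeBoxes {l : List ℕ} {j p : ℕ} (hj : j ≤ l.sum) (hp : 0 < p) :
    IsPartialSum (removeBoxes j l) p ↔ IsPartialSum l (j + p) := by
  induction l generalizing j with
  | nil =>
    simp only [List.sum_nil, nonpos_iff_eq_zero] at hj
    simp [removeBoxes, hj]
  | cons b bs ih =>
    rw [List.sum_cons] at hj
    by_cases h : j < b
    · simp only [removeBoxes, h, if_true, isPartialSum_cons,
        show p - (b - j) = j + p - b by omega, show b - j ≤ p ↔ b ≤ j + p by omega,
        show p ≠ 0 by omega, show j + p ≠ 0 by omega]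
    · simp only [removeBoxes, h, if_false, isPartialSum_cons, ih (show j - b ≤ bs.sum by omega),
        show j - b + p = j + p - b by omega, show j + p ≠ 0 by omega, false_or,
        show b ≤ j + p by omega, true_and]

theorem removeBoxes_sum_append (p : List ℕ) {q : List ℕ} (hq : ∀ b ∈ q, 0 < b) :
    removeBoxes p.sum (p ++ q) = q := by
  induction p with
  | nil => simpa using removeBoxes_zero hq
  | cons b bs ih => simp [removeBoxes, ih]

/-- What remains after removing boxes consists of full rows if and only if the number of removed
boxes is a partial sum of the row lengths. -/
theorem removeBoxes_suffix_iff {l : List ℕ} (hl : ∀ b ∈ l, 0 < b) {j : ℕ} (hj : j ≤ l.sum) :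
    removeBoxes j l <:+ l ↔ IsPartialSum l j := by
  constructor
  · rintro ⟨p, hp⟩
    refine ⟨p.length, ?_⟩
    have h := congrArg List.sum hp
    rw [List.sum_append, sum_removeBoxes] at h
    rw [← hp, List.take_left]
    omega
  · rintro ⟨i, rfl⟩
    have h := removeBoxes_sum_append (l.take i) (q := l.drop i)
      fun b hb => hl b (List.mem_of_mem_drop hb)
    rw [List.take_append_drop] at h
    rw [h]
    exact List.drop_suffix i l

-- Every row met by the first `j` boxes, except the top one, starts right after a partial sum
-- strictly between `0` and `j`. Positive row lengths make these partial sums distinct.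
open Classical in
theorem length_firstBoxes {l : List ℕ} (hl : ∀ b ∈ l, 0 < b) {j : ℕ} (hj : j ≤ l.sum)
    (hj0 : 0 < j) :
    (firstBoxes j l).length = {p ∈ Finset.Ioo 0 j | IsPartialSum l p}.card + 1 := by
  induction l generalizing j with
  | nil => simp at hj; omega
  | cons b bs ih =>
    simp only [List.mem_cons, forall_eq_or_imp] at hl
    rw [List.sum_cons] at hj
    by_cases h : j ≤ b
    · rw [firstBoxes, if_neg hj0.ne', if_pos h, List.length_singleton, right_eq_add,
        Finset.card_eq_zero, Finset.filter_eq_empty_iff]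
      intro p hp
      rw [Finset.mem_Ioo] at hp
      rw [isPartialSum_cons]
      omega
    · rw [firstBoxes, if_neg hj0.ne', if_neg h, List.length_cons, ih hl.2 (by omega) (by omega)]
      have key : {p ∈ Finset.Ioo 0 j | IsPartialSum (b :: bs) p} =
          insert b ({p ∈ Finset.Ioo 0 (j - b) | IsPartialSum bs p}.map (addRightEmbedding b)) := by
        ext p
        simp only [Finset.mem_filter, Finset.mem_Ioo, isPartialSum_cons, Finset.mem_insert,
          Finset.mem_map, addRightEmbedding_apply]
        constructor
        · rintro ⟨⟨h1, h2⟩, h3 | ⟨h3, h4⟩⟩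
          · omega
          · by_cases hp : p = b
            · exact Or.inl hp
            · exact Or.inr ⟨p - b, ⟨⟨by omega, by omega⟩, h4⟩, by omega⟩
        · rintro (rfl | ⟨q, ⟨⟨h1, h2⟩, h3⟩, rfl⟩)
          · exact ⟨⟨hl.1, by omega⟩, Or.inr ⟨le_rfl, by simpa using isPartialSum_zero bs⟩⟩
          · exact ⟨⟨by omega, by omega⟩, Or.inr ⟨by omega, by simpa using h3⟩⟩
      rw [key, Finset.card_insert_of_notMem, Finset.card_map]
      simp

/-! ### Boundaries of compositions -/

theorem mem_boundaries_iff {n : ℕ} (c : Composition n) (p : Fin (n + 1)) :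
    p ∈ c.boundaries ↔ ∃ i : Fin (c.length + 1), c.boundary i = p := by
  simp [Composition.boundaries]

theorem val_boundary {n : ℕ} (c : Composition n) (i : Fin (c.length + 1)) :
    (c.boundary i : ℕ) = c.sizeUpTo i := rfl

theorem mem_boundaries_iff_isPartialSum {n : ℕ} (c : Composition n) (p : Fin (n + 1)) :
    p ∈ c.boundaries ↔ IsPartialSum c.blocks p := by
  rw [mem_boundaries_iff]
  constructor
  · rintro ⟨i, rfl⟩
    exact ⟨i, rfl⟩
  · rintro ⟨i, hi⟩
    -- `IsPartialSum` does not bound the index, and `take` saturates at the length.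
    refine ⟨⟨min i c.length, by omega⟩, Fin.ext ?_⟩
    rw [← hi, val_boundary, Composition.sizeUpTo]
    rcases le_total i c.length with h | h
    · simp [h]
    · simp only [min_eq_right h]
      rw [List.take_of_length_le h, List.take_of_length_le le_rfl]

theorem boundary_mem_boundaries {n : ℕ} (c : Composition n) (i : Fin (c.length + 1)) :
    c.boundary i ∈ c.boundaries :=
  (mem_boundaries_iff c _).2 ⟨i, rfl⟩

theorem zero_mem_boundaries {n : ℕ} (c : Composition n) : 0 ∈ c.boundaries :=
  c.toCompositionAsSet.zero_mem

theorem last_mem_boundaries {n : ℕ} (c : Composition n) : Fin.last n ∈ c.boundaries :=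
  c.toCompositionAsSet.getLast_mem

theorem boundaries_ofCuts {n : ℕ} (S : Finset (Fin (n + 1))) :
    (ofCuts S).boundaries = insert 0 (insert (Fin.last n) S) :=
  CompositionAsSet.toComposition_boundaries _

theorem boundaries_injective {n : ℕ} :
    Function.Injective (Composition.boundaries : Composition n → Finset (Fin (n + 1))) := by
  intro a b h
  apply (compositionEquiv n).injective
  exact CompositionAsSet.ext h

theorem mem_cutSet {n : ℕ} (α : Composition n) (p : ℕ+ → ℕ+ → Prop) [DecidableRel p]
    (s : Fin (n + 1)) :
    s ∈ cutSet α p ↔ ∃ i : Fin α.length, ∃ h : (i : ℕ) + 1 < α.length,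
      s = α.boundary i.succ ∧ p (part α i) (part α ⟨i + 1, h⟩) := by
  simp only [cutSet, Finset.mem_filter, Finset.mem_univ, true_and, Fin.ext_iff, val_boundary,
    Fin.val_succ]

theorem boundary_succ_mem_cutSet {n : ℕ} (α : Composition n) (p : ℕ+ → ℕ+ → Prop)
    [DecidableRel p] (i : Fin α.length) (h : (i : ℕ) + 1 < α.length) :
    α.boundary i.succ ∈ cutSet α p ↔ p (part α i) (part α ⟨i + 1, h⟩) := by
  rw [mem_cutSet]
  constructor
  · rintro ⟨j, hj, e, hp⟩
    have := α.boundary.injective e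
    obtain rfl : i = j := Fin.succ_injective _ this
    exact hp
  · exact fun hp => ⟨i, h, rfl, hp⟩

theorem cutSet_subset_boundaries {n : ℕ} (α : Composition n) (p : ℕ+ → ℕ+ → Prop)
    [DecidableRel p] : cutSet α p ⊆ α.boundaries := by
  intro s hs
  obtain ⟨i, h, rfl, -⟩ := (mem_cutSet α p s).1 hs
  exact boundary_mem_boundaries α _

/-! ### The states of the algorithm -/

/-- The state of the algorithm for `β` and `α` after `t` iterations. -/
def stateAt {n : ℕ} (β α : Composition n) (t : ℕ) : RibbonState :=
  (α.blocks.take t).foldl (ribbonStep β.blocks) ⟨none, 0, β.blocks, fun _ => []⟩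

theorem stateAt_length {n : ℕ} (β α : Composition n) :
    stateAt β α α.length = ribbonRun β α := by
  rw [stateAt, ribbonRun, ← α.blocks_length, List.take_length]

theorem stateAt_succ {n : ℕ} (β α : Composition n) (i : Fin α.length) :
    stateAt β α (i + 1) = ribbonStep β.blocks (stateAt β α i) (α.blocksFun i) := by
  rw [stateAt, List.take_succ_eq_append_getElem (by simp), List.foldl_append]
  rfl

theorem rem_stateAt {n : ℕ} (β α : Composition n) {t : ℕ} (ht : t ≤ α.length) :
    (stateAt β α t).rem = removeBoxes (α.sizeUpTo t) β.blocks := by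
  induction t with
  | zero =>
    rw [α.sizeUpTo_zero, removeBoxes_zero fun b hb => β.one_le_blocks hb]
    rfl
  | succ t ih =>
    rw [stateAt_succ β α ⟨t, ht⟩, ribbonStep]
    simp only
    rw [ih (by omega), removeBoxes_removeBoxes, α.sizeUpTo_succ' ⟨t, ht⟩]

theorem prev_stateAt_succ {n : ℕ} (β α : Composition n) (i : Fin α.length) :
    (stateAt β α (i + 1)).prev = some (α.blocksFun i) := by
  rw [stateAt_succ]
  rfl

/-- This turns the south/east test of the algorithm into a condition on cuts: full rows remain
exactly when the boxes removed so far end with a row. -/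
theorem rem_stateAt_suffix_iff {n : ℕ} (β α : Composition n) (i : Fin α.length) :
    (stateAt β α i).rem <:+ β.blocks ↔ α.boundary i.castSucc ∈ β.boundaries := by
  rw [rem_stateAt β α i.2.le, removeBoxes_suffix_iff (fun b hb => β.one_le_blocks hb)
    (by rw [β.blocks_sum]; exact α.sizeUpTo_le _), mem_boundaries_iff_isPartialSum]
  rfl

theorem notMem_boundaries_of_lt_of_lt {n : ℕ} (α : Composition n) {t : ℕ} {p : Fin (n + 1)}
    (h1 : α.sizeUpTo t < p) (h2 : (p : ℕ) < α.sizeUpTo (t + 1)) : p ∉ α.boundaries := by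
  rw [mem_boundaries_iff]
  rintro ⟨i, rfl⟩
  rw [val_boundary] at h1 h2
  have h3 := α.monotone_sizeUpTo.reflect_lt h1
  have h4 := α.monotone_sizeUpTo.reflect_lt h2
  omega

/-- Each iteration contributes the partial sums of `β` strictly between two consecutive partial sums
of `α`; such points are never partial sums of `α`. -/
theorem ht_stateAt {n : ℕ} (β α : Composition n) {t : ℕ} (ht : t ≤ α.length) :
    (stateAt β α t).ht =
      ({p ∈ β.boundaries \ α.boundaries | (p : ℕ) < α.sizeUpTo t} : Finset (Fin (n + 1))).card := by
  classical
  induction t with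
  | zero => simp [stateAt]
  | succ t ih =>
    have hpos : ∀ b ∈ β.blocks, 0 < b := fun b hb => β.one_le_blocks hb
    have hle := α.sizeUpTo_le (t + 1)
    have hs := α.sizeUpTo_succ' ⟨t, ht⟩
    have ha := α.one_le_blocksFun ⟨t, ht⟩
    simp only at hs
    have hsum : α.sizeUpTo t ≤ β.blocks.sum := by rw [β.blocks_sum]; exact α.sizeUpTo_le t
    rw [stateAt_succ β α ⟨t, ht⟩, ribbonStep]
    simp only
    rw [ih (by omega), rem_stateAt β α (show t ≤ α.length by omega),
      length_firstBoxes (pos_of_mem_removeBoxes hpos _) (by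
        rw [sum_removeBoxes, β.blocks_sum]; omega) ha, Nat.add_sub_cancel]
    have h1 : ({p ∈ β.boundaries \ α.boundaries | (p : ℕ) < α.sizeUpTo (t + 1)} :
        Finset (Fin (n + 1))) =
        ({p ∈ β.boundaries \ α.boundaries | (p : ℕ) < α.sizeUpTo t} : Finset (Fin (n + 1))) ∪
        ({p ∈ β.boundaries | α.sizeUpTo t < (p : ℕ) ∧ (p : ℕ) < α.sizeUpTo (t + 1)} :
          Finset (Fin (n + 1))) := by
      ext p
      simp only [Finset.mem_filter, Finset.mem_sdiff, Finset.mem_union]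
      constructor
      · rintro ⟨⟨h1, h2⟩, h3⟩
        rcases lt_trichotomy (p : ℕ) (α.sizeUpTo t) with h | h | h
        · exact Or.inl ⟨⟨h1, h2⟩, h⟩
        · refine absurd ?_ h2
          rw [mem_boundaries_iff]
          exact ⟨⟨t, by omega⟩, Fin.ext h.symm⟩
        · exact Or.inr ⟨h1, h, h3⟩
      · rintro (⟨h1, h2⟩ | ⟨h1, h2, h3⟩)
        · exact ⟨h1, by omega⟩
        · exact ⟨⟨h1, notMem_boundaries_of_lt_of_lt α h2 h3⟩, h3⟩
    rw [h1, Finset.card_union_of_disjoint]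
    · congr 1
      -- Translation by the number of boxes already removed. The reduction modulo `n + 1` has no
      -- effect, as the translated values stay below `α.sizeUpTo (t + 1) ≤ n`.
      refine Finset.card_bij' (fun p _ => Fin.ofNat (n + 1) (p + α.sizeUpTo t))
        (fun p _ => (p : ℕ) - α.sizeUpTo t) ?_ ?_ ?_ ?_
      · intro p hp
        rw [Finset.mem_filter, Finset.mem_Ioo] at hp
        have hv : ((Fin.ofNat (n + 1) (p + α.sizeUpTo t) : Fin (n + 1)) : ℕ) =
            p + α.sizeUpTo t := by
          rw [Fin.val_ofNat, Nat.mod_eq_of_lt (by omega)]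
        rw [Finset.mem_filter, mem_boundaries_iff_isPartialSum, hv]
        refine ⟨?_, by omega, by omega⟩
        rw [add_comm, ← isPartialSum_removeBoxes hsum hp.1.1]
        exact hp.2
      · intro p hp
        rw [Finset.mem_filter, mem_boundaries_iff_isPartialSum] at hp
        rw [Finset.mem_filter, Finset.mem_Ioo]
        refine ⟨⟨by omega, by omega⟩, ?_⟩
        rw [isPartialSum_removeBoxes hsum (by omega), Nat.add_sub_cancel' hp.2.1.le]
        exact hp.1
      · intro p hp
        rw [Finset.mem_filter, Finset.mem_Ioo] at hp
        rw [Fin.val_ofNat, Nat.mod_eq_of_lt (by omega), Nat.add_sub_cancel]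
      · intro p hp
        rw [Finset.mem_filter] at hp
        ext
        rw [Fin.val_ofNat, Nat.sub_add_cancel hp.2.1.le, Nat.mod_eq_of_lt p.2]
    · rw [Finset.disjoint_left]
      intro p hp hp'
      rw [Finset.mem_filter] at hp hp'
      omega

/-- The height counts the partial sums of `β` that are not partial sums of `α`. -/
theorem height_eq {n : ℕ} (β α : Composition n) :
    height β α = (β.boundaries \ α.boundaries).card := by
  rw [height, ← stateAt_length, ht_stateAt β α le_rfl, Finset.filter_true_of_mem]
  intro p hp
  rw [α.sizeUpTo_length]
  refine lt_of_le_of_ne (Nat.lt_succ_iff.1 p.2) fun h => ?_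
  rw [Finset.mem_sdiff] at hp
  exact hp.2 ((Fin.ext h : p = Fin.last n) ▸ last_mem_boundaries α)

/-! ### The boxes of the ribbons -/

/-- The box that is added to a ribbon in the iteration for the `i`-th part of `α`. -/
def newCell {n : ℕ} (β α : Composition n) (i : Fin α.length) : ℕ × ℕ :=
  ((stateAt β α (i + 1)).ribbons (α.blocksFun i)).getLast?.getD (0, 0)

/-- An extended list is nonempty, so the default `(0, 0)` is never used. -/
theorem extend_eq_append (dr dc : ℕ) (l : List (ℕ × ℕ)) :
    extend dr dc l = l ++ [(extend dr dc l).getLast?.getD (0, 0)] := by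
  unfold extend
  cases h : l.getLast? with
  | none => simpa using h
  | some x => simp

theorem ribbons_stateAt_succ {n : ℕ} (β α : Composition n) (i : Fin α.length) (L : ℕ) :
    (stateAt β α (i + 1)).ribbons L = if α.blocksFun i = L then
      (stateAt β α i).ribbons L ++ [newCell β α i] else (stateAt β α i).ribbons L := by
  split_ifs with h
  · subst h
    rw [newCell, stateAt_succ, ribbonStep]
    simp only [Function.update_self]
    split_ifs <;> exact extend_eq_append _ _ _
  · rw [stateAt_succ, ribbonStep]
    simp only
    rw [Function.update_of_ne (Ne.symm h)]

theorem mem_ribbons_stateAt {n : ℕ} (β α : Composition n) (L : ℕ) (x : ℕ × ℕ) {t : ℕ}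
    (ht : t ≤ α.length) : x ∈ (stateAt β α t).ribbons L ↔
      ∃ i : Fin α.length, (i : ℕ) < t ∧ α.blocksFun i = L ∧ newCell β α i = x := by
  induction t with
  | zero => simp [stateAt]
  | succ t ih =>
    rw [ribbons_stateAt_succ β α ⟨t, ht⟩]
    simp only
    have key : (∃ i : Fin α.length, (i : ℕ) < t + 1 ∧ α.blocksFun i = L ∧ newCell β α i = x) ↔
        (∃ i : Fin α.length, (i : ℕ) < t ∧ α.blocksFun i = L ∧ newCell β α i = x) ∨
          (α.blocksFun ⟨t, ht⟩ = L ∧ newCell β α ⟨t, ht⟩ = x) := by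
      constructor
      · rintro ⟨i, h1, h2⟩
        rcases Nat.lt_succ_iff_lt_or_eq.1 h1 with h | h
        · exact Or.inl ⟨i, h, h2⟩
        · obtain rfl : i = ⟨t, ht⟩ := Fin.ext h
          exact Or.inr h2
      · rintro (⟨i, h1, h2⟩ | h)
        · exact ⟨i, by omega, h2⟩
        · exact ⟨_, Nat.lt_succ_self t, h⟩
    rw [key, ← ih (by omega)]
    split_ifs with h <;> simp [h, eq_comm]

theorem mem_ribbonCells {n : ℕ} (β α : Composition n) (L : ℕ) (x : ℕ × ℕ) :
    x ∈ ribbonCells β α L ↔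
      ∃ i : Fin α.length, α.blocksFun i = L ∧ newCell β α i = x := by
  rw [ribbonCells, List.mem_toFinset, ← stateAt_length, mem_ribbons_stateAt β α L x le_rfl]
  simp

theorem getLast?_ribbons_stateAt {n : ℕ} (β α : Composition n) (i : Fin α.length) {t : ℕ}
    (hi : (i : ℕ) + 1 ≤ t) (ht : t ≤ α.length)
    (h : ∀ j : Fin α.length, i < j → (j : ℕ) < t → α.blocksFun j ≠ α.blocksFun i) :
    ((stateAt β α t).ribbons (α.blocksFun i)).getLast? = some (newCell β α i) := by
  induction t, hi using Nat.le_induction with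
  | base => simp [ribbons_stateAt_succ β α i]
  | succ t hi ih =>
    rw [ribbons_stateAt_succ β α ⟨t, ht⟩, if_neg (h ⟨t, ht⟩ (Fin.lt_def.2 hi) (Nat.lt_succ_self t))]
    exact ih (by omega) fun j h1 h2 => h j h1 (by omega)

/-- Since `i` is the last part before `j` with the same value, the ribbon still ends with the box of
`i` when `j` is reached. -/
theorem newCell_eq {n : ℕ} (β α : Composition n) {i j : Fin α.length} (hij : i < j)
    (h : α.blocksFun i = α.blocksFun j)
    (hl : ∀ t : Fin α.length, i < t → t < j → α.blocksFun t ≠ α.blocksFun i) :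
    newCell β α j =
      if (i : ℕ) + 1 = j then
        if α.boundary j.castSucc ∈ β.boundaries then ((newCell β α i).1 + 1, (newCell β α i).2)
        else ((newCell β α i).1, (newCell β α i).2 + 1)
      else ((newCell β α i).1 + 1, (newCell β α i).2 + 1) := by
  have hlast := getLast?_ribbons_stateAt β α i (Nat.succ_le_of_lt hij) j.2.le hl
  obtain ⟨j', hj'⟩ : ∃ t, (j : ℕ) = t + 1 := ⟨j - 1, by rw [Fin.lt_def] at hij; omega⟩
  have hjl : j' < α.length := by omega
  have hprev := prev_stateAt_succ β α ⟨j', hjl⟩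
  simp only [← hj'] at hprev
  have hp : (i : ℕ) + 1 = j ↔ (stateAt β α j).prev = some (α.blocksFun j) := by
    rw [hprev, Option.some_inj, ← h]
    constructor
    · intro e
      congr 1
      ext
      simp only
      omega
    · intro e
      by_contra h'
      rw [Fin.lt_def] at hij
      exact hl ⟨j', hjl⟩ (by rw [Fin.lt_def]; simp only; omega)
        (by rw [Fin.lt_def]; simp only; omega) e
  rw [newCell, stateAt_succ, ribbonStep]
  simp only [Function.update_self, rem_stateAt_suffix_iff]
  rw [← h] at hp ⊢
  simp only [hp, ne_eq, ite_not, extend, hlast]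
  split_ifs <;> simp

/-- Every step along a ribbon goes south, east or southeast. So two boxes share a row only through
an unbroken run of east steps, and a column only through a run of south steps; such runs come from
consecutive equal parts. -/
theorem newCell_rel {n : ℕ} (β α : Composition n) {i j : Fin α.length} (hij : i < j)
    (h : α.blocksFun i = α.blocksFun j) :
    (newCell β α i).1 ≤ (newCell β α j).1 ∧ (newCell β α i).2 ≤ (newCell β α j).2 ∧
    (newCell β α i).1 + (newCell β α i).2 < (newCell β α j).1 + (newCell β α j).2 ∧
    ((newCell β α i).1 = (newCell β α j).1 → ∀ t : Fin α.length, i < t → t ≤ j →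
      α.blocksFun t = α.blocksFun i ∧ α.boundary t.castSucc ∉ β.boundaries) ∧
    ((newCell β α i).2 = (newCell β α j).2 → ∀ t : Fin α.length, i < t → t ≤ j →
      α.blocksFun t = α.blocksFun i ∧ α.boundary t.castSucc ∈ β.boundaries) := by
  induction j using WellFoundedLT.induction with
  | ind j ih =>
    -- `m` is the part whose box immediately precedes that of `j` in the ribbon.
    obtain ⟨m, hm, hmax⟩ := Finset.exists_max_image
      {m : Fin α.length | m < j ∧ α.blocksFun m = α.blocksFun j} id
      ⟨i, by simp [hij, h]⟩
    simp only [Finset.mem_filter, Finset.mem_univ, true_and, id] at hm hmax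
    have hstep := newCell_eq β α hm.1 hm.2 fun t h1 h2 h3 =>
      absurd (hmax t ⟨h2, h3.trans hm.2⟩) (not_le.2 h1)
    have hmj : (m : ℕ) + 1 = j → ∀ t : Fin α.length, m < t → t ≤ j → t = j := by
      intro e t h1 h2
      rw [Fin.lt_def] at h1
      rw [Fin.le_def] at h2
      ext
      omega
    have base : (newCell β α m).1 ≤ (newCell β α j).1 ∧ (newCell β α m).2 ≤ (newCell β α j).2 ∧
        (newCell β α m).1 + (newCell β α m).2 < (newCell β α j).1 + (newCell β α j).2 ∧
        ((newCell β α m).1 = (newCell β α j).1 → ∀ t : Fin α.length, m < t → t ≤ j →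
          α.blocksFun t = α.blocksFun m ∧ α.boundary t.castSucc ∉ β.boundaries) ∧
        ((newCell β α m).2 = (newCell β α j).2 → ∀ t : Fin α.length, m < t → t ≤ j →
          α.blocksFun t = α.blocksFun m ∧ α.boundary t.castSucc ∈ β.boundaries) := by
      rw [hstep]
      split_ifs with h1 h2
      · refine ⟨by simp, by simp, by simp, by simp, fun _ t h3 h4 => ?_⟩
        rw [hmj h1 t h3 h4]
        exact ⟨hm.2.symm, h2⟩
      · refine ⟨by simp, by simp, by simp [← add_assoc], fun _ t h3 h4 => ?_, by simp⟩
        rw [hmj h1 t h3 h4]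
        exact ⟨hm.2.symm, h2⟩
      · simp; omega
    rcases (hmax i ⟨hij, h⟩).eq_or_lt with rfl | him
    · exact base
    · obtain ⟨b1, b2, b3, b4, b5⟩ := base
      obtain ⟨c1, c2, c3, c4, c5⟩ := ih m hm.1 him (h.trans hm.2.symm)
      refine ⟨by omega, by omega, by omega, fun e t h1 h2 => ?_, fun e t h1 h2 => ?_⟩
      · rcases le_or_gt t m with h3 | h3
        · exact c4 (by omega) t h1 h3
        · rw [h, ← hm.2]
          exact b4 (by omega) t h3 h2
      · rcases le_or_gt t m with h3 | h3
        · exact c5 (by omega) t h1 h3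
        · rw [h, ← hm.2]
          exact b5 (by omega) t h3 h2

/-! ### Labelings of the parts of a composition -/

/-- The parts of `α` that are equal to `L`. -/
abbrev PartsEq {n : ℕ} (α : Composition n) (L : ℕ) : Type :=
  {i : Fin α.length // α.blocksFun i = L}

theorem card_partsEq {n : ℕ} (α : Composition n) (L : ℕ) :
    Fintype.card (PartsEq α L) = mult L α :=
  Fintype.card_subtype _

/-- For every `L`, the parts of `α` equal to `L` are labelled bijectively. -/
abbrev Labeling {n : ℕ} (α : Composition n) : Type :=
  (L : Finset.Icc 1 n) → (PartsEq α L ≃ Fin (mult L α))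

open Classical in
/-- The partial sums of `α` between adjacent equal parts with decreasing labels. -/
noncomputable def descents {n : ℕ} {α : Composition n} (σ : Labeling α) :
    Finset (Fin (n + 1)) :=
  {s | ∃ L : Finset.Icc 1 n, ∃ u v : PartsEq α L,
    (u.1 : ℕ) + 1 = v.1 ∧ σ L v < σ L u ∧ s = α.boundary v.1.castSucc}

/-- The partial sums of `α` between adjacent equal parts. -/
def plateaus {n : ℕ} (α : Composition n) : Finset (Fin (n + 1)) :=
  cutSet α fun a b => a = b

theorem blocksFun_mem_Icc {n : ℕ} (α : Composition n) (i : Fin α.length) :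
    α.blocksFun i ∈ Finset.Icc 1 n :=
  Finset.mem_Icc.2 ⟨α.one_le_blocksFun i, α.blocksFun_le i⟩

theorem mem_plateaus {n : ℕ} (α : Composition n) (s : Fin (n + 1)) :
    s ∈ plateaus α ↔ ∃ L : Finset.Icc 1 n, ∃ u v : PartsEq α L,
      (u.1 : ℕ) + 1 = v.1 ∧ s = α.boundary v.1.castSucc := by
  rw [plateaus, mem_cutSet]
  constructor
  · rintro ⟨i, h, rfl, e⟩
    refine ⟨⟨_, blocksFun_mem_Icc α i⟩, ⟨i, rfl⟩, ⟨⟨i + 1, h⟩, ?_⟩, rfl, rfl⟩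
    exact (congrArg PNat.val e).symm
  · rintro ⟨L, u, v, huv, rfl⟩
    have hv : v.1 = ⟨u.1 + 1, by omega⟩ := Fin.ext huv.symm
    refine ⟨u.1, by omega, ?_, ?_⟩
    · rw [hv]
      rfl
    · rw [← hv]
      exact PNat.eq (u.2.trans v.2.symm)

theorem mem_descents {n : ℕ} {α : Composition n} (σ : Labeling α) (s : Fin (n + 1)) :
    s ∈ descents σ ↔ ∃ L : Finset.Icc 1 n, ∃ u v : PartsEq α L,
      (u.1 : ℕ) + 1 = v.1 ∧ σ L v < σ L u ∧ s = α.boundary v.1.castSucc := by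
  simp [descents]

theorem boundary_castSucc_mem_descents {n : ℕ} {α : Composition n} (σ : Labeling α)
    {L : Finset.Icc 1 n} {u v : PartsEq α L} (huv : (u.1 : ℕ) + 1 = v.1) :
    α.boundary v.1.castSucc ∈ descents σ ↔ σ L v < σ L u := by
  rw [mem_descents]
  constructor
  · rintro ⟨L', ⟨u', hu'⟩, ⟨v', hv'⟩, h1, h2, h3⟩
    obtain ⟨u, hu⟩ := u
    obtain ⟨v, hv⟩ := v
    simp only at h1 h3 huv
    obtain rfl : v = v' := Fin.castSucc_injective _ (α.boundary.injective h3)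
    obtain rfl : u = u' := by ext; omega
    obtain rfl : L = L' := Subtype.ext (hv.symm.trans hv')
    exact h2
  · exact fun h => ⟨L, u, v, huv, h, rfl⟩

theorem descents_subset_plateaus {n : ℕ} {α : Composition n} (σ : Labeling α) :
    descents σ ⊆ plateaus α := by
  intro s hs
  obtain ⟨L, u, v, h1, -, h2⟩ := (mem_descents σ s).1 hs
  exact (mem_plateaus α s).2 ⟨L, u, v, h1, h2⟩

theorem descents_eq_inter_iff {n : ℕ} {α : Composition n} (σ : Labeling α)
    (S : Finset (Fin (n + 1))) : descents σ = S ∩ plateaus α ↔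
      ∀ L : Finset.Icc 1 n, ∀ u v : PartsEq α L, (u.1 : ℕ) + 1 = v.1 →
        (σ L v < σ L u ↔ α.boundary v.1.castSucc ∈ S) := by
  constructor
  · intro h L u v huv
    rw [← boundary_castSucc_mem_descents σ huv, h, Finset.mem_inter, and_iff_left]
    exact (mem_plateaus α _).2 ⟨L, u, v, huv, rfl⟩
  · intro h
    ext s
    rw [Finset.mem_inter, mem_descents, mem_plateaus]
    constructor
    · rintro ⟨L, u, v, h1, h2, rfl⟩
      exact ⟨(h L u v h1).1 h2, L, u, v, h1, rfl⟩
    · rintro ⟨h1, L, u, v, h2, rfl⟩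
      exact ⟨L, u, v, h2, (h L u v h2).2 h1, rfl⟩

theorem descents_subset_iff {n : ℕ} {α : Composition n} (σ : Labeling α)
    (S : Finset (Fin (n + 1))) : descents σ ⊆ S ↔
      ∀ L : Finset.Icc 1 n, ∀ u v : PartsEq α L, (u.1 : ℕ) + 1 = v.1 →
        σ L v < σ L u → α.boundary v.1.castSucc ∈ S := by
  constructor
  · intro h L u v huv hlt
    exact h ((boundary_castSucc_mem_descents σ huv).2 hlt)
  · intro h s hs
    obtain ⟨L, u, v, h1, h2, rfl⟩ := (mem_descents σ s).1 hs
    exact h L u v h1 h2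

/-- A transitive relation that holds between consecutive values of `f` holds between any two. -/
theorem rel_of_rel_consecutive {γ : Type*} (r : γ → γ → Prop) [IsTrans γ r] {N : ℕ}
    {p : Fin N → Prop} (f : {i // p i} → γ) {x y : {i // p i}} (hxy : x.1 < y.1)
    (hp : ∀ t, x.1 < t → t ≤ y.1 → p t)
    (hr : ∀ u v : {i // p i}, x.1 ≤ u.1 → v.1 ≤ y.1 → (u.1 : ℕ) + 1 = v.1 → r (f u) (f v)) :
    r (f x) (f y) := by
  obtain ⟨y, hy⟩ := y
  induction y using WellFoundedLT.induction with
  | ind y ih =>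
    simp only at hxy hp hr
    rw [Fin.lt_def] at hxy
    by_cases h : (x.1 : ℕ) + 1 = y
    · exact hr x ⟨y, hy⟩ le_rfl le_rfl h
    · have hlt : x.1 < (⟨y - 1, by omega⟩ : Fin N) := by rw [Fin.lt_def]; simp only; omega
      have hly : (⟨y - 1, by omega⟩ : Fin N) < y := by rw [Fin.lt_def]; simp only; omega
      have hpy := hp _ hlt hly.le
      refine _root_.trans (ih _ hly hpy hlt (fun t h1 h2 => hp t h1 (h2.trans hly.le))
        fun u v h1 h2 => hr u v h1 (h2.trans hly.le)) (hr ⟨_, hpy⟩ ⟨y, hy⟩ hlt.le le_rfl ?_)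
      simp only
      omega

/-! ### Descent ribbon fillings as labelings -/

theorem newCell_injective {n : ℕ} (β α : Composition n) {i j : Fin α.length}
    (h : α.blocksFun i = α.blocksFun j) (e : newCell β α i = newCell β α j) : i = j := by
  rcases lt_trichotomy i j with h1 | h1 | h1
  · have := (newCell_rel β α h1 h).2.2.1
    rw [e] at this
    omega
  · exact h1
  · have := (newCell_rel β α h1 h.symm).2.2.1
    rw [e] at this
    omega

/-- The boxes of the `L`-th ribbon correspond to the parts equal to `L`. -/
noncomputable def cellEquiv {n : ℕ} (β α : Composition n) (L : ℕ) :
    PartsEq α L ≃ ribbonCells β α L :=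
  Equiv.ofBijective (fun x => ⟨newCell β α x.1, (mem_ribbonCells β α L _).2 ⟨x.1, x.2, rfl⟩⟩) <| by
    constructor
    · intro x y h
      exact Subtype.ext (newCell_injective β α (x.2.trans y.2.symm) (congrArg Subtype.val h))
    · rintro ⟨c, hc⟩
      obtain ⟨i, hi, rfl⟩ := (mem_ribbonCells β α L _).1 hc
      exact ⟨⟨i, hi⟩, rfl⟩

theorem coe_cellEquiv {n : ℕ} (β α : Composition n) (L : ℕ) (x : PartsEq α L) :
    (cellEquiv β α L x : ℕ × ℕ) = newCell β α x.1 := rfl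

theorem card_ribbonCells {n : ℕ} (β α : Composition n) (L : ℕ) :
    (ribbonCells β α L).card = mult L α := by
  rw [← card_partsEq, Fintype.card_congr (cellEquiv β α L), Fintype.card_coe]

/-- By `newCell_rel`, row and column conditions follow by transitivity from neighbouring boxes of
consecutive equal parts: an east step forces an ascent, a south step a descent. Southeast steps
impose nothing. -/
theorem isStandardDescent_iff {n : ℕ} (β α : Composition n) (L : ℕ)
    (f : ribbonCells β α L ≃ Fin (ribbonCells β α L).card) :
    IsStandardDescent f ↔ ∀ u v : PartsEq α L, (u.1 : ℕ) + 1 = v.1 →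
      (f (cellEquiv β α L v) < f (cellEquiv β α L u) ↔
        α.boundary v.1.castSucc ∈ β.boundaries) := by
  constructor
  · rintro ⟨hrow, hcol⟩ u v huv
    have hlt : u.1 < v.1 := by rw [Fin.lt_def]; omega
    have hcell := newCell_eq β α hlt (u.2.trans v.2.symm) fun t h1 h2 => by
      rw [Fin.lt_def] at h1 h2; omega
    rw [if_pos huv] at hcell
    split_ifs at hcell with h
    · refine iff_of_true (hcol _ _ ?_ ?_) h <;> simp [coe_cellEquiv, hcell]
    · refine iff_of_false (not_lt.2 (hrow _ _ ?_ ?_).le) h <;> simp [coe_cellEquiv, hcell]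
  · intro h
    constructor
    · intro x y h1 h2
      obtain ⟨x, rfl⟩ := (cellEquiv β α L).surjective x
      obtain ⟨y, rfl⟩ := (cellEquiv β α L).surjective y
      rw [coe_cellEquiv, coe_cellEquiv] at h1 h2
      have hxy : x.1 < y.1 := by
        by_contra hle
        rcases (not_lt.1 hle).eq_or_lt with e | hlt
        · rw [e] at h2; omega
        · have := (newCell_rel β α hlt (y.2.trans x.2.symm)).2.1
          omega
      have hrel := (newCell_rel β α hxy (x.2.trans y.2.symm)).2.2.2.1 h1
      refine rel_of_rel_consecutive (· < ·) (fun x => f (cellEquiv β α L x)) hxy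
        (fun t h3 h4 => (hrel t h3 h4).1.trans x.2) fun u v h3 h4 huv => ?_
      refine lt_of_le_of_ne ?_ fun e => ?_
      · refine not_lt.1 fun hlt => (hrel v.1 ?_ h4).2 ((h u v huv).1 hlt)
        rw [Fin.lt_def]; rw [Fin.le_def] at h3; omega
      · have := congrArg (fun x => (x.1 : ℕ)) ((cellEquiv β α L).injective (f.injective e))
        omega
    · intro x y h1 h2
      obtain ⟨x, rfl⟩ := (cellEquiv β α L).surjective x
      obtain ⟨y, rfl⟩ := (cellEquiv β α L).surjective y
      rw [coe_cellEquiv, coe_cellEquiv] at h1 h2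
      have hxy : x.1 < y.1 := by
        by_contra hle
        rcases (not_lt.1 hle).eq_or_lt with e | hlt
        · rw [e] at h2; omega
        · have := (newCell_rel β α hlt (y.2.trans x.2.symm)).1
          omega
      have hrel := (newCell_rel β α hxy (x.2.trans y.2.symm)).2.2.2.2 h1
      refine rel_of_rel_consecutive (· > ·) (fun x => f (cellEquiv β α L x)) hxy
        (fun t h3 h4 => (hrel t h3 h4).1.trans x.2) fun u v h3 h4 huv => ?_
      refine (h u v huv).2 (hrel v.1 ?_ h4).2
      rw [Fin.lt_def]; rw [Fin.le_def] at h3; omega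

/-- The conditions for different `L` are independent, so the local description of fillings assembles
over the product. In particular `β` enters only through its cuts at plateaus of `α`. -/
theorem card_SDR {n : ℕ} (β α : Composition n) :
    Nat.card (SDR β α) =
      Nat.card {σ : Labeling α // descents σ = β.boundaries ∩ plateaus α} := by
  let Q : (L : Finset.Icc 1 n) → (PartsEq α L ≃ Fin (mult L α)) → Prop := fun L g =>
    ∀ u v : PartsEq α L, (u.1 : ℕ) + 1 = v.1 →
      (g v < g u ↔ α.boundary v.1.castSucc ∈ β.boundaries)
  have e1 : {σ : Labeling α // descents σ = β.boundaries ∩ plateaus α} ≃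
      ((L : Finset.Icc 1 n) → {g // Q L g}) :=
    (Equiv.subtypeEquivRight fun σ => descents_eq_inter_iff σ β.boundaries).trans
      (show {σ : Labeling α // ∀ L, Q L (σ L)} ≃ _ from Equiv.subtypePiEquivPi)
  refine Nat.card_congr (Equiv.trans (Equiv.piCongrRight fun L => ?_) e1.symm)
  refine (Equiv.equivCongr (cellEquiv β α L).symm
    (finCongr (card_ribbonCells β α L))).subtypeEquiv fun f => ?_
  rw [isStandardDescent_iff]
  rfl

/-! ### Counting fiberwise increasing bijections -/

theorem exists_perm_strictMono {F γ : Type*} [LinearOrder F] [Fintype F] [LinearOrder γ]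
    (f : F → γ) (hf : Function.Injective f) : ∃ g : Equiv.Perm F, StrictMono (f ∘ g) := by
  let e : Fin (Fintype.card F) ≃o F := Fintype.orderIsoFinOfCardEq F rfl
  refine ⟨(e.symm.toEquiv.trans (Tuple.sort (f ∘ e))).trans e.toEquiv, ?_⟩
  refine Monotone.strictMono_of_injective ?_ (hf.comp (Equiv.injective _))
  intro x y hxy
  exact Tuple.monotone_sort (f ∘ e) (e.symm.monotone hxy)

/-- Such a `g` is an order automorphism of a finite linear order, hence trivial. -/
theorem perm_eq_one_of_strictMono {F γ : Type*} [LinearOrder F] [Finite F] [LinearOrder γ]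
    {f : F → γ} {g : Equiv.Perm F} (hf : StrictMono f) (hg : StrictMono (f ∘ g)) : g = 1 := by
  have hmono : StrictMono g := fun x y hxy => hf.lt_iff_lt.1 (hg hxy)
  have h : hmono.orderIsoOfSurjective g g.surjective = OrderIso.refl F := Subsingleton.elim _ _
  ext x
  exact congrArg (fun e : F ≃o F => e x) h

/-- The number of bijections that increase on every fiber of `π`, times the number of permutations
that preserve the fibers, is the number of all bijections. -/
theorem card_increasing_mul {X ι : Type*} [LinearOrder X] [Fintype X] [Fintype ι] [DecidableEq ι]
    (π : X → ι) {m : ℕ} (hm : Fintype.card X = m) :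
    Nat.card {f : X ≃ Fin m // ∀ x y, x < y → π x = π y → f x < f y} *
      ∏ j, (Fintype.card {x // π x = j}).factorial = m.factorial := by
  rw [← DomMulAct.stabilizer_card π, ← Nat.card_eq_fintype_card, ← Nat.card_prod]
  have hcard : Nat.card (X ≃ Fin m) = m.factorial := by
    rw [Nat.card_eq_fintype_card, Fintype.card_equiv (Fintype.equivFinOfCardEq hm), hm]
  rw [← hcard]
  -- Every bijection factors uniquely as a fiber-preserving permutation followed by a fiberwise
  -- increasing bijection.
  refine Nat.card_congr (Equiv.ofBijective (fun p => p.2.1.trans p.1.1) ⟨?_, ?_⟩)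
  · rintro ⟨⟨f, hf⟩, ⟨g, hg⟩⟩ ⟨⟨f', hf'⟩, ⟨g', hg'⟩⟩ h
    simp only at h
    have hgx : ∀ x, π (g x) = π x := congrFun hg
    have hgx' : ∀ x, π (g' x) = π x := congrFun hg'
    have hcomp : ∀ x, f' (g' (g.symm x)) = f x := by
      intro x
      have := congrArg (fun e : X ≃ Fin m => e (g.symm x)) h
      simpa using this.symm
    have hpres : ∀ j x, π x = j ↔ π ((g.symm.trans g') x) = j := by
      intro j x
      rw [Equiv.trans_apply, hgx', ← hgx (g.symm x), Equiv.apply_symm_apply]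
    -- On each fiber both `f'` and its composite with this permutation, which is `f`, are
    -- increasing.
    have hone : ∀ x, g' (g.symm x) = x := by
      intro x
      have h1 := perm_eq_one_of_strictMono (F := {y // π y = π x}) (f := fun y => f' y.1)
        (g := Equiv.Perm.subtypePerm (g.symm.trans g') fun y => (hpres (π x) y).symm)
        (fun y z hyz => hf' _ _ hyz (y.2.trans z.2.symm)) (fun y z hyz => by
          simp only [Function.comp, Equiv.Perm.subtypePerm_apply, Equiv.trans_apply, hcomp]
          exact hf _ _ hyz (y.2.trans z.2.symm))
      exact congrArg (fun e : Equiv.Perm {y // π y = π x} => (e ⟨x, rfl⟩).1) h1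
    obtain rfl : g = g' := by
      ext x
      have := hone (g x)
      rw [Equiv.symm_apply_apply] at this
      exact this.symm
    obtain rfl : f = f' := by
      ext x
      rw [← hcomp x, Equiv.apply_symm_apply]
    rfl
  · intro τ
    choose g hg using fun j => exists_perm_strictMono (fun x : {x // π x = j} => τ x.1)
      (τ.injective.comp Subtype.val_injective)
    -- `G` glues the permutations that sort `τ` on the fibers; then `τ` is `G.symm` followed by the
    -- increasing `G.trans τ`.
    let G : Equiv.Perm X := (Equiv.sigmaFiberEquiv π).symm.trans
      ((Equiv.sigmaCongrRight g).trans (Equiv.sigmaFiberEquiv π))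
    have hG : ∀ x, G x = (g (π x) ⟨x, rfl⟩).1 := fun x => rfl
    have hGπ : ∀ x, π (G x) = π x := fun x => (g (π x) ⟨x, rfl⟩).2
    have hGj : ∀ j (x : {x // π x = j}), G x.1 = (g j x).1 := by
      rintro j ⟨x, rfl⟩
      rfl
    refine ⟨⟨⟨G.trans τ, ?_⟩, ⟨G.symm, ?_⟩⟩, ?_⟩
    · intro x y hxy hπ
      have h1 := hGj (π y) ⟨x, hπ⟩
      have h2 := hGj (π y) ⟨y, rfl⟩
      simp only at h1 h2
      change τ (G x) < τ (G y)
      rw [h1, h2]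
      exact hg (π y) (show (⟨x, hπ⟩ : {x // π x = π y}) < ⟨y, rfl⟩ from hxy)
    · funext x
      rw [Function.comp_apply, ← hGπ, Equiv.apply_symm_apply]
    · ext x
      simp

/-! ### Labelings whose descents are boundaries of a coarser composition -/

theorem sizeUpTo_lt {n : ℕ} (α : Composition n) (i : Fin α.length) : α.sizeUpTo i < n :=
  (α.sizeUpTo_strict_mono i.2).trans_le (α.sizeUpTo_le _)

/-- The part of `β` to which the `i`-th part of `α` is summed, if `α ≤ β`. -/
def blockOf {n : ℕ} (α β : Composition n) (i : Fin α.length) : Fin β.length :=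
  β.index ⟨α.sizeUpTo i, sizeUpTo_lt α i⟩

theorem blockOf_eq_iff_lt {n : ℕ} (α β : Composition n) (i : Fin α.length) (j : Fin β.length) :
    blockOf α β i = j ↔
      β.sizeUpTo j ≤ α.sizeUpTo i ∧ α.sizeUpTo i < β.sizeUpTo (j + 1) := by
  have h1 := β.sizeUpTo_index_le ⟨α.sizeUpTo i, sizeUpTo_lt α i⟩
  have h2 := β.lt_sizeUpTo_index_succ ⟨α.sizeUpTo i, sizeUpTo_lt α i⟩
  constructor
  · rintro rfl
    exact ⟨h1, h2⟩
  · rintro ⟨h3, h4⟩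
    have h5 := β.monotone_sizeUpTo.reflect_lt (h1.trans_lt h4)
    have h6 := β.monotone_sizeUpTo.reflect_lt (h3.trans_lt h2)
    rw [Fin.val_succ] at h6
    ext
    rw [blockOf]
    omega

/-- When `α ≤ β`, no part of `α` straddles a boundary of `β`, so a part that starts in a block also
ends there. -/
theorem blockOf_eq_iff {n : ℕ} {α β : Composition n} (h : Refines α β) (i : Fin α.length)
    (j : Fin β.length) : blockOf α β i = j ↔
      β.sizeUpTo j ≤ α.sizeUpTo i ∧ α.sizeUpTo (i + 1) ≤ β.sizeUpTo (j + 1) := by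
  rw [blockOf_eq_iff_lt, and_congr_right_iff]
  intro _
  obtain ⟨m, hm⟩ := (mem_boundaries_iff α _).1 (h (boundary_mem_boundaries β j.succ))
  have hm' : α.sizeUpTo m = β.sizeUpTo (j + 1) := congrArg Fin.val hm
  rw [← hm']
  constructor
  · intro hlt
    exact α.monotone_sizeUpTo (α.monotone_sizeUpTo.reflect_lt hlt)
  · exact (α.sizeUpTo_strict_mono i.2).trans_le

theorem boundary_notMem_of_blockOf_eq {n : ℕ} {α β : Composition n} {u v t : Fin α.length}
    (h : blockOf α β u = blockOf α β v) (h1 : u < t) (h2 : t ≤ v) :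
    α.boundary t.castSucc ∉ β.boundaries := by
  have hu := ((blockOf_eq_iff_lt α β u _).1 h).1
  have hv := ((blockOf_eq_iff_lt α β v _).1 rfl).2
  have h3 : α.sizeUpTo u < α.sizeUpTo t :=
    (α.sizeUpTo_strict_mono u.2).trans_le (α.monotone_sizeUpTo (Fin.lt_def.1 h1))
  have h4 : α.sizeUpTo t ≤ α.sizeUpTo v := α.monotone_sizeUpTo (Fin.le_def.1 h2)
  exact notMem_boundaries_of_lt_of_lt β (hu.trans_lt h3) (h4.trans_lt hv)

theorem blockOf_eq_of_boundary_notMem {n : ℕ} {α β : Composition n} (hαβ : Refines α β)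
    {u v : Fin α.length} (huv : (u : ℕ) + 1 = v) (h : α.boundary v.castSucc ∉ β.boundaries) :
    blockOf α β u = blockOf α β v := by
  have hv := (blockOf_eq_iff_lt α β v _).1 rfl
  have hlt := α.sizeUpTo_strict_mono u.2
  rw [huv] at hlt
  rw [blockOf_eq_iff_lt]
  refine ⟨?_, hlt.trans hv.2⟩
  -- Otherwise the block of `v` starts after the start of part `u`: either at the excluded cut, or
  -- strictly inside part `u`, against `α ≤ β`.
  by_contra hle
  have hmem := boundary_mem_boundaries β (blockOf α β v).castSucc
  rcases hv.1.eq_or_lt with e | h1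
  · refine h ?_
    rwa [show α.boundary v.castSucc = β.boundary (blockOf α β v).castSucc from Fin.ext e.symm]
  · rw [← huv] at h1
    exact notMem_boundaries_of_lt_of_lt α (p := β.boundary (blockOf α β v).castSucc)
      (not_le.1 hle) h1 (hαβ hmem)

/-- All ascents are cuts of `β`, so within a block the parts decrease weakly for `prec`; equal
values at two places force constancy in between. -/
theorem blocksFun_eq_of_blockOf_eq (prec : ℕ+ → ℕ+ → Prop) [IsStrictTotalOrder ℕ+ prec]
    [DecidableRel prec] {n : ℕ} {α β : Composition n}
    (hC : cutSet α (fun a b => prec a b) ⊆ β.boundaries)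
    {u v t : Fin α.length} (h : blockOf α β u = blockOf α β v)
    (huv : α.blocksFun u = α.blocksFun v) (h1 : u < t) (h2 : t ≤ v) :
    α.blocksFun t = α.blocksFun u := by
  let r : ℕ+ → ℕ+ → Prop := fun a b => a = b ∨ prec b a
  have hr : IsTrans ℕ+ r := ⟨by
    rintro a b c (rfl | hab) (rfl | hbc)
    · exact Or.inl rfl
    · exact Or.inr hbc
    · exact Or.inr hab
    · exact Or.inr (_root_.trans hbc hab)⟩
  have hstep : ∀ i j : Fin α.length, u ≤ i → j ≤ v → (i : ℕ) + 1 = j →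
      r (part α i) (part α j) := by
    intro i j hi hj hij
    have hlt : u < j := by rw [Fin.lt_def]; rw [Fin.le_def] at hi; omega
    have hnot := boundary_notMem_of_blockOf_eq h hlt hj
    have hb : α.boundary j.castSucc = α.boundary i.succ := by
      congr 1
      exact Fin.ext hij.symm
    have hj' : (⟨i + 1, by omega⟩ : Fin α.length) = j := Fin.ext hij
    have hnp : ¬ prec (part α i) (part α j) := by
      intro hp
      rw [hb] at hnot
      refine hnot (hC ((boundary_succ_mem_cutSet α _ i (by omega)).2 ?_))
      rw [hj']
      exact hp
    rcases trichotomous_of prec (part α i) (part α j) with h' | h' | h'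
    · exact absurd h' hnp
    · exact Or.inl h'
    · exact Or.inr h'
  have hchain : ∀ i j : Fin α.length, u ≤ i → j ≤ v → i < j → r (part α i) (part α j) := by
    intro i j hi hj hij
    exact rel_of_rel_consecutive r (p := fun _ => True) (fun i => part α i.1)
      (x := ⟨i, trivial⟩) (y := ⟨j, trivial⟩) hij (fun _ _ _ => trivial)
      fun a b ha hb => hstep a.1 b.1 (hi.trans ha) (hb.trans hj)
  have huv' : part α u = part α v := PNat.eq huv
  have key : part α t = part α u := by
    rcases h2.eq_or_lt with rfl | h2
    · exact huv'.symm
    · rcases hchain u t le_rfl h2.le h1 with e | h3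
      · exact e.symm
      · rcases hchain t v h1.le le_rfl h2 with e | h4
        · exact e.trans huv'.symm
        · rw [← huv'] at h4
          exact absurd h4 (asymm_of prec h3)
  exact congrArg PNat.val key

theorem card_descents_subset (prec : ℕ+ → ℕ+ → Prop) [IsStrictTotalOrder ℕ+ prec]
    [DecidableRel prec] {n : ℕ} {α β : Composition n} (hαβ : Refines α β)
    (hC : cutSet α (fun a b => prec a b) ⊆ β.boundaries) :
    Nat.card {σ : Labeling α // descents σ ⊆ β.boundaries} = coeffC α β := by
  let Q : (L : Finset.Icc 1 n) → (PartsEq α L ≃ Fin (mult L α)) → Prop := fun L g =>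
    ∀ u v : PartsEq α L, (u.1 : ℕ) + 1 = v.1 → g v < g u →
      α.boundary v.1.castSucc ∈ β.boundaries
  have e1 : {σ : Labeling α // descents σ ⊆ β.boundaries} ≃
      ((L : Finset.Icc 1 n) → {g // Q L g}) :=
    (Equiv.subtypeEquivRight fun σ => descents_subset_iff σ β.boundaries).trans
      (show {σ : Labeling α // ∀ L, Q L (σ L)} ≃ _ from Equiv.subtypePiEquivPi)
  rw [Nat.card_congr e1, Nat.card_pi, coeffC,
    ← Finset.prod_coe_sort (Finset.Icc 1 n) fun L => (mult L α).factorial / multInFactorial L α β]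
  refine Finset.prod_congr rfl fun L _ => ?_
  -- Equal parts in one block are contiguous, so increasing across each uncut plateau means
  -- increasing on each block.
  have hQ : ∀ g : PartsEq α L ≃ Fin (mult L α), Q L g ↔
      ∀ x y : PartsEq α L, x < y → blockOf α β x.1 = blockOf α β y.1 → g x < g y := by
    intro g
    constructor
    · intro hg x y hxy hb
      refine rel_of_rel_consecutive (· < ·) g hxy (fun t h1 h2 =>
        (blocksFun_eq_of_blockOf_eq prec hC hb (x.2.trans y.2.symm) h1 h2).trans x.2)
        fun u v h1 h2 huv => lt_of_le_of_ne (not_lt.1 fun hlt => ?_) fun e => ?_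
      · refine boundary_notMem_of_blockOf_eq hb ?_ h2 (hg u v huv hlt)
        rw [Fin.lt_def]; rw [Fin.le_def] at h1; omega
      · have := g.injective e
        subst this
        omega
    · intro hg u v huv hlt
      by_contra hnot
      refine (hg u v ?_ (blockOf_eq_of_boundary_notMem hαβ huv hnot)).not_gt hlt
      change u.1 < v.1
      rw [Fin.lt_def]
      omega
  have hmain := card_increasing_mul (fun x : PartsEq α L => blockOf α β x.1)
    (card_partsEq α L)
  have hfib : ∀ j, Fintype.card {x : PartsEq α L // blockOf α β x.1 = j} = multIn L α β j := by
    intro j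
    rw [Fintype.card_congr (Equiv.subtypeSubtypeEquivSubtypeInter _ fun i => blockOf α β i = j),
      Fintype.card_subtype, multIn]
    congr 1
    refine Finset.filter_congr fun i _ => ?_
    rw [blockOf_eq_iff hαβ]
    tauto
  simp only [hfib] at hmain
  rw [Nat.card_congr (Equiv.subtypeEquivRight hQ), ← hmain, multInFactorial,
    Nat.mul_div_cancel _ (Finset.prod_pos fun _ _ => Nat.factorial_pos _)]

/-! ### The coefficients of the expansion in fundamental quasisymmetric functions -/

theorem zero_notMem_cutSet {n : ℕ} (α : Composition n) (p : ℕ+ → ℕ+ → Prop) [DecidableRel p] :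
    0 ∉ cutSet α p := by
  rw [mem_cutSet]
  rintro ⟨i, h, e, -⟩
  rw [← α.boundary_zero] at e
  exact Fin.succ_ne_zero i (α.boundary.injective e).symm

theorem last_notMem_cutSet {n : ℕ} (α : Composition n) (p : ℕ+ → ℕ+ → Prop) [DecidableRel p] :
    Fin.last n ∉ cutSet α p := by
  rw [mem_cutSet]
  rintro ⟨i, h, e, -⟩
  rw [← α.boundary_last] at e
  have := congrArg Fin.val (α.boundary.injective e)
  simp only [Fin.val_last, Fin.val_succ] at this
  omega

theorem disjoint_cutSet {n : ℕ} (α : Composition n) (p q : ℕ+ → ℕ+ → Prop) [DecidableRel p]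
    [DecidableRel q] (h : ∀ a b, p a b → ¬ q a b) : Disjoint (cutSet α p) (cutSet α q) := by
  rw [Finset.disjoint_left]
  intro s hs hq
  obtain ⟨i, hi, rfl, hp⟩ := (mem_cutSet α p s).1 hs
  exact h _ _ hp ((boundary_succ_mem_cutSet α q i hi).1 hq)

theorem mem_boundaries_cases (prec : ℕ+ → ℕ+ → Prop) [IsStrictTotalOrder ℕ+ prec]
    [DecidableRel prec] {n : ℕ} (α : Composition n) {s : Fin (n + 1)} (hs : s ∈ α.boundaries) :
    s = 0 ∨ s = Fin.last n ∨ s ∈ cutSet α (fun a b => prec a b) ∨ s ∈ plateaus α ∨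
      s ∈ cutSet α (fun a b => prec b a) := by
  obtain ⟨i, rfl⟩ := (mem_boundaries_iff α s).1 hs
  rcases Fin.eq_zero_or_eq_succ i with rfl | ⟨j, rfl⟩
  · exact Or.inl α.boundary_zero
  · by_cases hj : (j : ℕ) + 1 < α.length
    · rw [plateaus, boundary_succ_mem_cutSet α _ j hj, boundary_succ_mem_cutSet α _ j hj,
        boundary_succ_mem_cutSet α _ j hj]
      exact Or.inr (Or.inr (trichotomous_of prec _ _))
    · refine Or.inr (Or.inl ?_)
      rw [← α.boundary_last]
      congr 1
      ext
      simp only [Fin.val_succ, Fin.val_last]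
      omega

theorem refines_upperComp_iff (prec : ℕ+ → ℕ+ → Prop) [DecidableRel prec] {n : ℕ}
    (α β : Composition n) :
    Refines β (upperComp prec α) ↔ cutSet α (fun a b => prec a b) ⊆ β.boundaries := by
  rw [Refines, upperComp, boundaries_ofCuts, Finset.insert_subset_iff, Finset.insert_subset_iff]
  simp only [zero_mem_boundaries, last_mem_boundaries, true_and]

/-- The complement of a cut set already contains `0` and `n`, so inserting them changes nothing. -/
theorem lowerComp_refines_iff (prec : ℕ+ → ℕ+ → Prop) [DecidableRel prec] {n : ℕ}
    (α β : Composition n) :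
    Refines (lowerComp prec α) β ↔ Disjoint β.boundaries (cutSet α fun a b => prec b a) := by
  rw [Refines, lowerComp, boundaries_ofCuts, Finset.insert_eq_of_mem, Finset.insert_eq_of_mem,
    Finset.subset_compl_iff_disjoint_right]
  · simpa using last_notMem_cutSet α _
  · simp [zero_notMem_cutSet]

/-- Adding or removing the cut `s`. -/
def toggleCut {n : ℕ} (s : Fin (n + 1)) (γ : Composition n) : Composition n :=
  ofCuts (symmDiff γ.boundaries {s})

theorem boundaries_toggleCut {n : ℕ} {s : Fin (n + 1)} (γ : Composition n) (h0 : s ≠ 0)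
    (hl : s ≠ Fin.last n) : (toggleCut s γ).boundaries = symmDiff γ.boundaries {s} := by
  rw [toggleCut, boundaries_ofCuts, Finset.insert_eq_of_mem (a := Fin.last n),
    Finset.insert_eq_of_mem (a := (0 : Fin (n + 1)))]
  · simp [Finset.mem_symmDiff, zero_mem_boundaries, h0.symm]
  · simp [Finset.mem_symmDiff, last_mem_boundaries, hl.symm]

/-! ### Cancellation along cuts outside `S(α)` -/

theorem neg_one_pow_card_add_symmDiff {R : Type*} [CommRing R] {ι : Type*} [DecidableEq ι]
    (X Y : Finset ι) {s : ι} (hs : s ∉ Y) :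
    (-1 : R) ^ (X \ Y).card + (-1) ^ (symmDiff X {s} \ Y).card = 0 := by
  by_cases h : s ∈ X
  · have e : symmDiff X {s} \ Y = (X \ Y).erase s := by
      ext t
      simp only [Finset.mem_sdiff, Finset.mem_symmDiff, Finset.mem_singleton, Finset.mem_erase]
      by_cases ht : t = s
      · subst ht; tauto
      · tauto
    rw [e, ← Finset.card_erase_add_one (Finset.mem_sdiff.2 ⟨h, hs⟩), pow_succ]
    ring
  · have e : symmDiff X {s} \ Y = insert s (X \ Y) := by
      ext t
      simp only [Finset.mem_sdiff, Finset.mem_symmDiff, Finset.mem_singleton, Finset.mem_insert]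
      by_cases ht : t = s
      · subst ht; tauto
      · tauto
    rw [e, Finset.card_insert_of_notMem (by simp [h]), pow_succ]
    ring

theorem card_SDR_toggleCut {n : ℕ} {α : Composition n} {s : Fin (n + 1)} (γ : Composition n)
    (hs : s ∉ α.boundaries) : Nat.card (SDR (toggleCut s γ) α) = Nat.card (SDR γ α) := by
  have h0 : s ≠ 0 := fun h => hs (h ▸ zero_mem_boundaries α)
  have hl : s ≠ Fin.last n := fun h => hs (h ▸ last_mem_boundaries α)
  rw [card_SDR, card_SDR, boundaries_toggleCut γ h0 hl]
  have e : symmDiff γ.boundaries {s} ∩ plateaus α = γ.boundaries ∩ plateaus α := by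
    ext t
    simp only [Finset.mem_inter, Finset.mem_symmDiff, Finset.mem_singleton]
    have : t ∈ plateaus α → t ≠ s := fun ht h => hs (h ▸ cutSet_subset_boundaries α _ ht)
    tauto
  rw [e]

/-- Toggling a point `s` of `S(β)` outside `S(α)` is a sign-reversing involution without fixed
points. The bounds by `T(α)` and `C(α)` only concern points of `S(α)`, and `s ∈ S(β)` preserves `β ≤
γ`. -/
theorem sum_eq_zero_of_not_refines (R : Type*) [CommRing R] (prec : ℕ+ → ℕ+ → Prop)
    [DecidableRel prec] {n : ℕ} (α β : Composition n) (h : ¬ Refines α β) :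
    ∑ γ : Composition n with (Refines (lowerComp prec α) γ ∧ Refines γ (upperComp prec α)) ∧
      Refines β γ, (-1 : R) ^ height γ α * (Nat.card (SDR γ α) : R) = 0 := by
  obtain ⟨s, hsβ, hsα⟩ := Finset.not_subset.1 h
  have h0 : s ≠ 0 := fun h => hsα (h ▸ zero_mem_boundaries α)
  have hl : s ≠ Fin.last n := fun h => hsα (h ▸ last_mem_boundaries α)
  refine Finset.sum_involution (fun γ _ => toggleCut s γ) ?_ ?_ ?_ ?_
  · intro γ _
    rw [card_SDR_toggleCut γ hsα, height_eq, height_eq, boundaries_toggleCut γ h0 hl, ← add_mul,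
      neg_one_pow_card_add_symmDiff _ _ hsα, zero_mul]
  · intro γ _ _ e
    have := congrArg Composition.boundaries e
    rw [boundaries_toggleCut γ h0 hl] at this
    simp at this
  · intro γ hγ
    simp only [Finset.mem_filter, Finset.mem_univ, true_and, refines_upperComp_iff,
      lowerComp_refines_iff, boundaries_toggleCut γ h0 hl] at hγ ⊢
    rw [Refines] at hγ ⊢
    rw [boundaries_toggleCut γ h0 hl]
    obtain ⟨⟨h1, h2⟩, h3⟩ := hγ
    refine ⟨⟨?_, ?_⟩, ?_⟩
    · rw [Finset.disjoint_left] at h1 ⊢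
      intro t ht ht'
      have hts : t ≠ s := fun h => hsα (h ▸ cutSet_subset_boundaries α _ ht')
      refine h1 ?_ ht'
      simpa [Finset.mem_symmDiff, hts] using ht
    · intro t ht
      have hts : t ≠ s := fun h => hsα (h ▸ cutSet_subset_boundaries α _ ht)
      simpa [Finset.mem_symmDiff, hts] using h2 ht
    · intro t ht
      rw [Finset.mem_symmDiff, Finset.mem_singleton] at ht
      rcases ht with ⟨h4, -⟩ | ⟨rfl, -⟩
      · exact h3 h4
      · exact hsβ
  · intro γ _
    apply boundaries_injective
    rw [boundaries_toggleCut _ h0 hl, boundaries_toggleCut _ h0 hl, symmDiff_symmDiff_cancel_right]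

open Classical in
theorem sum_card_SDR (prec : ℕ+ → ℕ+ → Prop) [IsStrictTotalOrder ℕ+ prec]
    [DecidableRel prec] {n : ℕ} {α β : Composition n} (hαβ : Refines α β)
    (hC : cutSet α (fun a b => prec a b) ⊆ β.boundaries) :
    ∑ γ : Composition n with (Refines (lowerComp prec α) γ ∧ Refines γ (upperComp prec α)) ∧
      Refines β γ, Nat.card (SDR γ α) = coeffC α β := by
  rw [← card_descents_subset prec hαβ hC, Nat.card_eq_fintype_card, Fintype.card_subtype]
  set asc := cutSet α (fun a b => prec a b) with hasc
  -- The only `γ` that can count `σ`: all ascents are forced cuts, strict descents are forbidden,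
  -- and the cuts at plateaus must be the descents of `σ`.
  let f : Labeling α → Composition n := fun σ => ofCuts (asc ∪ descents σ)
  have hf : ∀ σ, (f σ).boundaries = insert 0 (insert (Fin.last n) (asc ∪ descents σ)) :=
    fun σ => boundaries_ofCuts _
  have hdisj1 : Disjoint asc (plateaus α) :=
    disjoint_cutSet α _ _ fun a b h e => irrefl_of prec b (e ▸ h)
  have hdisj2 : Disjoint asc (cutSet α fun a b => prec b a) :=
    disjoint_cutSet α _ _ fun a b h => asymm_of prec h
  have hdisj3 : Disjoint (plateaus α) (cutSet α fun a b => prec b a) :=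
    disjoint_cutSet α _ _ fun a b e h => irrefl_of prec b (e ▸ h)
  have hzero : ∀ (p : ℕ+ → ℕ+ → Prop) [DecidableRel p] {s}, s ∈ cutSet α p →
      s ≠ 0 ∧ s ≠ Fin.last n := fun p _ s hs =>
    ⟨fun h => zero_notMem_cutSet α p (h ▸ hs), fun h => last_notMem_cutSet α p (h ▸ hs)⟩
  rw [Finset.card_eq_sum_card_fiberwise (f := f)
    (t := {γ : Composition n | (Refines (lowerComp prec α) γ ∧ Refines γ (upperComp prec α)) ∧
      Refines β γ})]
  · refine Finset.sum_congr rfl fun γ hγ => ?_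
    simp only [Finset.mem_filter, Finset.mem_univ, true_and, refines_upperComp_iff,
      lowerComp_refines_iff] at hγ
    rw [← hasc, Refines] at hγ
    obtain ⟨⟨h1, h2⟩, h3⟩ := hγ
    rw [card_SDR, Nat.card_eq_fintype_card, Fintype.card_subtype]
    congr 1
    ext σ
    simp only [Finset.mem_filter, Finset.mem_univ, true_and]
    constructor
    · intro h
      refine ⟨?_, boundaries_injective ?_⟩
      · rw [h]
        exact Finset.inter_subset_left.trans h3
      · rw [hf, h]
        refine Finset.Subset.antisymm ?_ ?_
        · refine Finset.insert_subset (zero_mem_boundaries γ)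
            (Finset.insert_subset (last_mem_boundaries γ) (Finset.union_subset h2 ?_))
          exact Finset.inter_subset_left
        · intro s hs
          simp only [Finset.mem_insert, Finset.mem_union, Finset.mem_inter]
          -- A cut of `γ` is one of `β`, hence of `α`, so it falls into one of these classes; `T(α)
          -- ≤ γ` rules out the last.
          rcases mem_boundaries_cases prec α (hαβ (h3 hs)) with h' | h' | h' | h' | h'
          · exact Or.inl h'
          · exact Or.inr (Or.inl h')
          · exact Or.inr (Or.inr (Or.inl h'))
          · exact Or.inr (Or.inr (Or.inr ⟨hs, h'⟩))
          · exact absurd h' (Finset.disjoint_left.1 h1 hs)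
    · rintro ⟨-, rfl⟩
      rw [hf]
      ext s
      simp only [Finset.mem_insert, Finset.mem_union, Finset.mem_inter]
      constructor
      · exact fun h => ⟨Or.inr (Or.inr (Or.inr h)), descents_subset_plateaus σ h⟩
      · rintro ⟨h | h | h | h, h'⟩
        · exact absurd h (hzero _ h').1
        · exact absurd h (hzero _ h').2
        · exact absurd h' (Finset.disjoint_left.1 hdisj1 h)
        · exact h
  · intro σ hσ
    simp only [Finset.coe_filter, Set.mem_ofPred_eq, Finset.mem_univ, true_and] at hσ ⊢
    rw [refines_upperComp_iff, lowerComp_refines_iff, Refines, hf]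
    refine ⟨⟨?_, ?_⟩, ?_⟩
    · rw [Finset.disjoint_left]
      intro s hs hs'
      simp only [Finset.mem_insert, Finset.mem_union] at hs
      rcases hs with h | h | h | h
      · exact (hzero _ hs').1 h
      · exact (hzero _ hs').2 h
      · exact Finset.disjoint_left.1 hdisj2 h hs'
      · exact Finset.disjoint_left.1 hdisj3 (descents_subset_plateaus σ h) hs'
    · intro s hs
      simp only [Finset.mem_insert, Finset.mem_union]
      exact Or.inr (Or.inr (Or.inl hs))
    · exact Finset.insert_subset (zero_mem_boundaries β)
        (Finset.insert_subset (last_mem_boundaries β) (Finset.union_subset hC hσ))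

theorem sum_neg_one_pow_height_mul_card_SDR (R : Type*) [CommRing R] (prec : ℕ+ → ℕ+ → Prop)
    [IsStrictTotalOrder ℕ+ prec] [DecidableRel prec] {n : ℕ} (α β : Composition n) :
    ∑ γ : Composition n with (Refines (lowerComp prec α) γ ∧ Refines γ (upperComp prec α)) ∧
      Refines β γ, (-1 : R) ^ height γ α * (Nat.card (SDR γ α) : R) =
    if Refines α β ∧ Refines β (upperComp prec α) then (coeffC α β : R) else 0 := by
  split_ifs with h
  · obtain ⟨h1, h2⟩ := h
    rw [← sum_card_SDR prec h1 ((refines_upperComp_iff prec α β).1 h2), Nat.cast_sum]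
    refine Finset.sum_congr rfl fun γ hγ => ?_
    have h3 : γ.boundaries ⊆ α.boundaries := (Finset.mem_filter.1 hγ).2.2.trans h1
    rw [height_eq, Finset.sdiff_eq_empty_iff_subset.2 h3, Finset.card_empty, pow_zero, one_mul]
  · by_cases h1 : Refines α β
    · refine Finset.sum_eq_zero fun γ hγ => absurd ⟨h1, ?_⟩ h
      have h2 := (Finset.mem_filter.1 hγ).2
      exact h2.1.2.trans h2.2
    · exact sum_eq_zero_of_not_refines R prec α β h1

end QuasiPowersum

theorem mainTheorem12 {R : Type*} [CommRing R] (prec : ℕ+ → ℕ+ → Prop)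
    [IsStrictTotalOrder ℕ+ prec] [DecidableRel prec] {n : ℕ} (α : Composition n) :
    QuasiPowersum.powersumQ R prec α =
      ∑ β : Composition n with
          QuasiPowersum.Refines (QuasiPowersum.lowerComp prec α) β ∧
          QuasiPowersum.Refines β (QuasiPowersum.upperComp prec α),
        ((-1) ^ QuasiPowersum.height β α * (Nat.card (QuasiPowersum.SDR β α) : R)) •
          QuasiPowersum.fundamentalQ R β := by
  classical
  unfold QuasiPowersum.powersumQ QuasiPowersum.fundamentalQ
  simp_rw [Finset.smul_sum, Finset.sum_filter (s := Finset.univ)]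
  -- Only the range of `γ` is restored as a filter; `β ≤ γ` stays an indicator, so the two sums can
  -- be exchanged and the coefficients of each `M_β` compared.
  simp_rw [← Finset.sum_filter (fun γ : Composition n =>
    QuasiPowersum.Refines (QuasiPowersum.lowerComp prec α) γ ∧
      QuasiPowersum.Refines γ (QuasiPowersum.upperComp prec α))]
  rw [Finset.sum_comm]
  refine Finset.sum_congr rfl fun β _ => ?_
  rw [← Finset.sum_filter, Finset.filter_filter, ← Finset.sum_smul,
    QuasiPowersum.sum_neg_one_pow_height_mul_card_SDR, ite_smul, zero_smul]
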